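/- Let $H$ be a finite-dimensional complex Hilbert space, and call an operator $\rho$ on $H$ a density matrix if it is positive semidefinite and $\operatorname{Tr}\rho=1$. Let $S(\rho)=-\operatorname{Tr}(\rho\log\rho)$ denote the von Neumann entropy (natural logarithm, $0\log 0=0$), and let $\|T\|_1=\operatorname{Tr}\sqrt{T^*T}$ denote the trace norm. Then for all density matrices $\rho,\sigma$ on $H$ and all $c\in[0,1]$, $$S(c\rho+(1-c)\sigma)-cS(\rho)-(1-c)S(\sigma)\ \ge\ \tfrac12\,c(1-c)\,\|\rho-\sigma\|_1^2 .$$ -/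

import Mathlib

/-- The trace of an operator on a finite-dimensional complex Hilbert space. -/
noncomputable def opTrace {H : Type*} [NormedAddCommGroup H] [InnerProductSpace ℂ H]
    (T : H →L[ℂ] H) : ℂ :=
  LinearMap.trace ℂ H (T : H →ₗ[ℂ] H)

/-- A density matrix (density operator): a positive semidefinite operator of trace one. -/
structure IsDensityMatrix {H : Type*} [NormedAddCommGroup H] [InnerProductSpace ℂ H]
    (ρ : H →L[ℂ] H) : Prop where
  isPositive : ρ.IsPositive
  trace_eq_one : opTrace ρ = 1

/-- The von Neumann entropy `S(ρ) = -Tr(ρ log ρ)` of a density matrix (natural logarithm): the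
trace of `η(ρ)`, formed by functional calculus, where `η(x) = -x log x` and `η(0) = 0`.
The trace of a self-adjoint operator is real, so taking the real part loses nothing. -/
noncomputable def vonNeumannEntropy {H : Type*} [NormedAddCommGroup H] [InnerProductSpace ℂ H]
    [CompleteSpace H] (ρ : H →L[ℂ] H) : ℝ :=
  (opTrace (cfc Real.negMulLog ρ)).re

/-- The trace norm `‖T‖₁ = Tr |T|`, where `|T| = (T* T)^{1/2}`. -/
noncomputable def traceNorm {H : Type*} [NormedAddCommGroup H] [InnerProductSpace ℂ H]
    [CompleteSpace H] (T : H →L[ℂ] H) : ℝ :=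
  (opTrace (CFC.abs T)).re

open scoped InnerProductSpace

/-! ### The scalar divergence inequality. -/

section ScalarInequality

/-! Put τ = cρ + (1-c)σ and D(ρ‖τ) = Tr ρ(log ρ - log τ). The entropy gap equals c D(ρ‖τ) + (1-c)
D(σ‖τ). Since ρ - τ = (1-c)(ρ - σ) and σ - τ = -c(ρ - σ), Pinsker's inequality bounds it below by
½(c(1-c)² + (1-c)c²)‖ρ - σ‖₁², and the coefficient is ½c(1-c).

Pinsker (`IsDensityMatrix.traceNorm_sub_sq_le`) is proved directly in eigenbases u of ρ and v of τ,
with eigenvalues p, q. Then D is the sum of |⟪u i, v j⟫|² g(p i, q j), where g(p, q) = p log p - p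
log q - p + q, and `sq_sub_le_relativeEntropy` controls (p - q)² by g. Writing ‖ρ - τ‖₁ = Tr U(ρ -
τ) with U a self-adjoint unitary, Cauchy–Schwarz leaves D times a factor equal to 2. -/

theorem hasDerivAt_log_sub_pade {u : ℝ} (hu : 0 < u) :
    HasDerivAt (fun x : ℝ => Real.log x - (5 * x ^ 2 - 4 * x - 1) / (2 * x ^ 2 + 4 * x))
      ((u - 1) ^ 3 / (u ^ 2 * (u + 2) ^ 2)) u := by
  have h1 : HasDerivAt (fun x : ℝ => 5 * x ^ 2 - 4 * x - 1) (5 * (2 * u) - 4) u := by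
    simpa using (((hasDerivAt_pow 2 u).const_mul 5).sub ((hasDerivAt_id u).const_mul 4)).sub_const 1
  have h2 : HasDerivAt (fun x : ℝ => 2 * x ^ 2 + 4 * x) (2 * (2 * u) + 4) u := by
    simpa using ((hasDerivAt_pow 2 u).const_mul 2).fun_add ((hasDerivAt_id u).const_mul 4)
  have h3 : (2 * u ^ 2 + 4 * u) ≠ 0 := by positivity
  refine ((Real.hasDerivAt_log hu.ne').fun_sub (h1.fun_div h2 h3)).congr_deriv ?_
  have h4 : u + 2 ≠ 0 := by positivity
  have h5 : 2 * u ^ 2 + 4 * u = 2 * u * (u + 2) := by ring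
  rw [h5]
  field_simp
  ring

/-- A rational lower bound for the logarithm, agreeing with it to third order at `1`. -/
theorem log_sub_pade_nonneg {u : ℝ} (hu : 0 < u) :
    0 ≤ Real.log u - (5 * u ^ 2 - 4 * u - 1) / (2 * u ^ 2 + 4 * u) := by
  set f : ℝ → ℝ := fun x => Real.log x - (5 * x ^ 2 - 4 * x - 1) / (2 * x ^ 2 + 4 * x) with hf
  have hf1 : f 1 = 0 := by norm_num [hf]
  change 0 ≤ f u
  rw [← hf1]
  -- The derivative has the sign of (x - 1)³, so `f` is minimal at 1.
  rcases le_total 1 u with h | h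
  · have hmono : MonotoneOn f (Set.Ici 1) := by
      refine monotoneOn_of_hasDerivWithinAt_nonneg (convex_Ici 1)
        (f' := fun x => (x - 1) ^ 3 / (x ^ 2 * (x + 2) ^ 2)) ?_ ?_ ?_
      · exact fun x hx => (hasDerivAt_log_sub_pade
          (zero_lt_one.trans_le hx)).continuousAt.continuousWithinAt
      · intro x hx
        rw [interior_Ici] at hx
        exact (hasDerivAt_log_sub_pade (zero_lt_one.trans hx)).hasDerivWithinAt
      · intro x hx
        rw [interior_Ici, Set.mem_Ioi] at hx
        have : 0 ≤ x - 1 := by linarith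
        positivity
    exact hmono (Set.mem_Ici.2 le_rfl) h h
  · have hanti : AntitoneOn f (Set.Ioc 0 1) := by
      refine antitoneOn_of_hasDerivWithinAt_nonpos (convex_Ioc 0 1)
        (f' := fun x => (x - 1) ^ 3 / (x ^ 2 * (x + 2) ^ 2)) ?_ ?_ ?_
      · exact fun x hx => (hasDerivAt_log_sub_pade hx.1).continuousAt.continuousWithinAt
      · intro x hx
        rw [interior_Ioc] at hx
        exact (hasDerivAt_log_sub_pade hx.1).hasDerivWithinAt
      · intro x hx
        rw [interior_Ioc] at hx
        have h0 : (x - 1) ^ 3 ≤ 0 := Odd.pow_nonpos (by decide) (by linarith [hx.2])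
        exact div_nonpos_of_nonpos_of_nonneg h0 (by positivity)
    exact hanti ⟨hu, h⟩ ⟨zero_lt_one, le_rfl⟩ h

/-- The scalar inequality behind Pinsker's inequality. -/
theorem sq_sub_le_relativeEntropy {p q : ℝ} (hp : 0 ≤ p) (hq : 0 < q) :
    (p - q) ^ 2 ≤ (p * Real.log p - p * Real.log q - p + q) * ((2 * p + 4 * q) / 3) := by
  rcases hp.eq_or_lt with rfl | hp
  · simp; nlinarith
  -- At u = p/q the rational bound, with denominators cleared, is exactly the claim.
  have h := log_sub_pade_nonneg (div_pos hp hq)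
  rw [Real.log_div hp.ne' hq.ne', sub_nonneg] at h
  have e : (5 * (p / q) ^ 2 - 4 * (p / q) - 1) / (2 * (p / q) ^ 2 + 4 * (p / q)) =
      (5 * p ^ 2 - 4 * p * q - q ^ 2) / (p * (2 * p + 4 * q)) := by
    field_simp
  rw [e, div_le_iff₀ (by positivity)] at h
  nlinarith

end ScalarInequality

section Trace

variable {H : Type*} [NormedAddCommGroup H] [InnerProductSpace ℂ H]

theorem opTrace_add [FiniteDimensional ℂ H] (A B : H →L[ℂ] H) :
    opTrace (A + B) = opTrace A + opTrace B := by
  simp [opTrace]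

theorem opTrace_smul (c : ℂ) (A : H →L[ℂ] H) : opTrace (c • A) = c * opTrace A := by
  simp [opTrace]

theorem opTrace_eq_sum_inner {ι : Type*} [Fintype ι] (A : H →L[ℂ] H)
    (b : OrthonormalBasis ι ℂ H) : opTrace A = ∑ i, ⟪b i, A (b i)⟫_ℂ :=
  LinearMap.trace_eq_sum_inner _ b

theorem opTrace_mul_eq_sum_inner {ι κ : Type*} [Fintype ι] [Fintype κ] (A B : H →L[ℂ] H)
    (u : OrthonormalBasis ι ℂ H) (v : OrthonormalBasis κ ℂ H) :
    opTrace (A * B) = ∑ j, ∑ i, ⟪v j, A (u i)⟫_ℂ * ⟪u i, B (v j)⟫_ℂ := by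
  rw [opTrace_eq_sum_inner _ v]
  refine Finset.sum_congr rfl fun j _ => ?_
  rw [mul_apply_eq_comp]
  conv_lhs => rw [← u.sum_repr' (B (v j))]
  simp [map_sum, mul_comm]

end Trace

section Symmetry

variable {H : Type*} [NormedAddCommGroup H] [InnerProductSpace ℂ H] [CompleteSpace H]

theorem norm_apply_of_symmetry {U : H →L[ℂ] H} (hU : IsSelfAdjoint U) (h : U * U = 1) (x : H) :
    ‖U x‖ = ‖x‖ := by
  have h1 : ⟪U x, U x⟫_ℂ = ⟪x, x⟫_ℂ := by
    have := hU.isSymmetric x (U x)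
    change ⟪U x, U x⟫_ℂ = ⟪x, (U * U) x⟫_ℂ at this
    rw [this, h]; rfl
  rw [inner_self_eq_norm_sq_to_K, inner_self_eq_norm_sq_to_K] at h1
  have h2 : ‖U x‖ ^ 2 = ‖x‖ ^ 2 := by exact_mod_cast h1
  exact (sq_eq_sq₀ (norm_nonneg _) (norm_nonneg _)).1 h2

end Symmetry

/-! ### Functional calculus on eigenvectors. -/

section FunctionalCalculus

variable {H : Type*} [NormedAddCommGroup H] [InnerProductSpace ℂ H] [FiniteDimensional ℂ H]

theorem finite_real_spectrum (A : H →L[ℂ] H) : (spectrum ℝ A).Finite := by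
  have h : (spectrum ℂ A).Finite := by
    have := Module.End.finite_spectrum (A : H →ₗ[ℂ] H)
    rwa [← AlgEquiv.spectrum_eq (Module.End.toContinuousLinearMap (𝕜 := ℂ) H)] at this
  rw [← spectrum.preimage_algebraMap ℂ]
  exact h.preimage (FaithfulSMul.algebraMap_injective ℝ ℂ).injOn

/-- Lets `cfc` accept functions discontinuous at 0, such as log and the sign. -/
theorem continuousOn_real_spectrum (f : ℝ → ℝ) (A : H →L[ℂ] H) : ContinuousOn f (spectrum ℝ A) :=
  (finite_real_spectrum A).continuousOn f

variable [CompleteSpace H]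

theorem cfc_apply_eigenvector {A : H →L[ℂ] H} (hA : IsSelfAdjoint A) (f : ℝ → ℝ) {r : ℝ} {x : H}
    (hx : A x = (r : ℂ) • x) : cfc f A x = (f r : ℂ) • x := by
  classical
  -- Interpolation on the spectrum reduces `f` to a polynomial. The node `r` is added because `x`
  -- may be 0, so `r` need not be an eigenvalue.
  set s : Finset ℝ := insert r (finite_real_spectrum A).toFinset with hs
  set P : Polynomial ℝ := Lagrange.interpolate s id f with hP
  have heval : ∀ y ∈ s, P.eval y = f y := fun y hy =>
    Lagrange.eval_interpolate_at_node f (Set.injOn_id _) hy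
  have hpoly : ∀ Q : Polynomial ℝ, Polynomial.aeval A Q x = ((Q.eval r : ℝ) : ℂ) • x := by
    intro Q
    induction Q using Polynomial.induction_on' with
    | add p q hp hq => simp [hp, hq, add_smul]
    | monomial n a =>
      have hpow : (A ^ n) x = ((r : ℂ) ^ n) • x := by
        induction n with
        | zero => simp
        | succ n ih => rw [pow_succ, mul_apply_eq_comp, hx, map_smul, ih, smul_smul]; ring_nf
      rw [Polynomial.aeval_monomial, mul_apply_eq_comp, hpow,
        Algebra.algebraMap_eq_smul_one]
      simp [mul_smul, smul_comm a]
  have hcongr : cfc f A = cfc (fun y => P.eval y) A :=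
    cfc_congr fun y hy => (heval y (by simp [hs, hy])).symm
  rw [hcongr, cfc_polynomial P A hA, hpoly, heval r (by simp [hs])]

/-- Spectral theorem for self-adjoint continuous operators. -/
theorem exists_eigenbasis {A : H →L[ℂ] H} (hA : IsSelfAdjoint A) :
    ∃ (u : OrthonormalBasis (Fin (Module.finrank ℂ H)) ℂ H) (p : Fin (Module.finrank ℂ H) → ℝ),
      ∀ i, A (u i) = (p i : ℂ) • u i :=
  have hs : (A : H →ₗ[ℂ] H).IsSymmetric := hA.isSymmetric
  ⟨hs.eigenvectorBasis rfl, hs.eigenvalues rfl, hs.apply_eigenvectorBasis rfl⟩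

theorem opTrace_cfc {ι : Type*} [Fintype ι] {A : H →L[ℂ] H} (hA : IsSelfAdjoint A) (f : ℝ → ℝ)
    {u : OrthonormalBasis ι ℂ H} {p : ι → ℝ} (hu : ∀ i, A (u i) = (p i : ℂ) • u i) :
    opTrace (cfc f A) = ((∑ i, f (p i) : ℝ) : ℂ) := by
  rw [opTrace_eq_sum_inner _ u]
  push_cast
  refine Finset.sum_congr rfl fun i _ => ?_
  simp [cfc_apply_eigenvector hA f (hu i)]

theorem opTrace_mul_cfc {ι κ : Type*} [Fintype ι] [Fintype κ] {A B : H →L[ℂ] H}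
    (hB : IsSelfAdjoint B) (f : ℝ → ℝ)
    {u : OrthonormalBasis ι ℂ H} {v : OrthonormalBasis κ ℂ H} {p : ι → ℝ} {q : κ → ℝ}
    (hu : ∀ i, A (u i) = (p i : ℂ) • u i) (hv : ∀ j, B (v j) = (q j : ℂ) • v j) :
    opTrace (A * cfc f B) = ((∑ j, ∑ i, ‖⟪u i, v j⟫_ℂ‖ ^ 2 * (p i * f (q j)) : ℝ) : ℂ) := by
  rw [opTrace_mul_eq_sum_inner _ _ u v]
  push_cast
  refine Finset.sum_congr rfl fun j _ => Finset.sum_congr rfl fun i _ => ?_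
  rw [hu, cfc_apply_eigenvector hB f (hv j), inner_smul_right, inner_smul_right,
    ← inner_conj_symm (v j) (u i), ← Complex.conj_mul']
  ring

/-- The trace norm of a self-adjoint operator is attained by a self-adjoint unitary. -/
theorem exists_symmetry_opTrace_mul {A : H →L[ℂ] H} (hA : IsSelfAdjoint A) :
    ∃ U : H →L[ℂ] H, IsSelfAdjoint U ∧ U * U = 1 ∧ traceNorm A = (opTrace (U * A)).re := by
  -- The value 1 at 0 makes the square the identity on the kernel too.
  set s : ℝ → ℝ := fun x => if 0 ≤ x then 1 else -1 with hs
  refine ⟨cfc s A, cfc_predicate s A, ?_, ?_⟩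
  · rw [← cfc_mul s s A (continuousOn_real_spectrum _ _) (continuousOn_real_spectrum _ _),
      ← cfc_one ℝ A]
    refine cfc_congr fun x _ => ?_
    by_cases h : 0 ≤ x <;> simp [hs, h]
  · have h : cfc s A * A = CFC.abs A := by
      rw [CFC.abs_eq_cfc_norm A hA]
      nth_rewrite 2 [← cfc_id' ℝ A hA]
      rw [← cfc_mul s _ A (continuousOn_real_spectrum _ _) (continuousOn_real_spectrum _ _)]
      refine cfc_congr fun x _ => ?_
      by_cases h : 0 ≤ x
      · simp [hs, h, abs_of_nonneg]
      · simp [hs, h, abs_of_neg (not_le.1 h)]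
    rw [h, traceNorm]

end FunctionalCalculus


section Eigenbasis

variable {H : Type*} [NormedAddCommGroup H] [InnerProductSpace ℂ H]

theorem ContinuousLinearMap.IsPositive.eigenvalue_nonneg {ι : Type*} [Fintype ι] {A : H →L[ℂ] H}
    (hA : A.IsPositive) {u : OrthonormalBasis ι ℂ H} {p : ι → ℝ}
    (hu : ∀ i, A (u i) = (p i : ℂ) • u i) (i : ι) : 0 ≤ p i := by
  have h := hA.re_inner_nonneg_right (u i)
  rw [hu, inner_smul_right, inner_self_eq_norm_sq_to_K] at h
  simpa using h

theorem inner_apply_of_apply_eq_smul [CompleteSpace H] {A : H →L[ℂ] H} (hA : IsSelfAdjoint A)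
    {x : H} {r : ℝ} (hx : A x = (r : ℂ) • x) (y : H) : ⟪x, A y⟫_ℂ = (r : ℂ) * ⟪x, y⟫_ℂ := by
  have := hA.isSymmetric x y
  change ⟪A x, y⟫_ℂ = ⟪x, A y⟫_ℂ at this
  rw [← this, hx, inner_smul_left, Complex.conj_ofReal]

theorem IsDensityMatrix.mix [FiniteDimensional ℂ H] {ρ σ : H →L[ℂ] H} (hρ : IsDensityMatrix ρ) (hσ : IsDensityMatrix σ)
    {c : ℝ} (hc0 : 0 ≤ c) (hc1 : c ≤ 1) :
    IsDensityMatrix ((c : ℂ) • ρ + ((1 - c : ℝ) : ℂ) • σ) where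
  isPositive := (hρ.isPositive.smul_of_nonneg (by exact_mod_cast hc0)).add
    (hσ.isPositive.smul_of_nonneg (by exact_mod_cast sub_nonneg.2 hc1))
  trace_eq_one := by
    rw [opTrace_add, opTrace_smul, opTrace_smul, hρ.trace_eq_one, hσ.trace_eq_one]
    push_cast; ring

theorem traceNorm_smul [CompleteSpace H] (r : ℝ) (A : H →L[ℂ] H) :
    traceNorm ((r : ℂ) • A) = |r| * traceNorm A := by
  rw [traceNorm, CFC.abs_smul, traceNorm, Complex.norm_real, Real.norm_eq_abs,
    ← Complex.coe_smul, opTrace_smul, Complex.re_ofReal_mul]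

end Eigenbasis

/-! ### Quantum Pinsker inequality. -/

section Pinsker

variable {H : Type*} [NormedAddCommGroup H] [InnerProductSpace ℂ H] [CompleteSpace H]
  [FiniteDimensional ℂ H]

theorem IsDensityMatrix.sum_eigenvalues {ι : Type*} [Fintype ι] {ρ : H →L[ℂ] H}
    (hρ : IsDensityMatrix ρ) {u : OrthonormalBasis ι ℂ H} {p : ι → ℝ}
    (hu : ∀ i, ρ (u i) = (p i : ℂ) • u i) : ∑ i, p i = 1 := by
  have h := opTrace_cfc hρ.isPositive.isSelfAdjoint (fun x => x) hu
  rw [cfc_id' ℝ ρ hρ.isPositive.isSelfAdjoint, hρ.trace_eq_one] at h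
  exact_mod_cast h.symm

/-- Between the two eigenbases, ρ - τ has entries (p i - q j)⟪u i, v j⟫; expand Tr U(ρ - τ) and
apply Cauchy–Schwarz. In the application `d` sums to the relative entropy and `m` is a weighted mean
of eigenvalues. -/
theorem traceNorm_sub_sq_le_sum_mul_sum {ι κ : Type*} [Fintype ι] [Fintype κ] {ρ τ : H →L[ℂ] H}
    (hρ : IsSelfAdjoint ρ) (hτ : IsSelfAdjoint τ) {u : OrthonormalBasis ι ℂ H}
    {v : OrthonormalBasis κ ℂ H} {p : ι → ℝ} {q : κ → ℝ}
    (hu : ∀ i, ρ (u i) = (p i : ℂ) • u i) (hv : ∀ j, τ (v j) = (q j : ℂ) • v j)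
    {m d : κ × ι → ℝ} (hm : ∀ x, 0 ≤ m x) (hd : ∀ x, 0 ≤ d x)
    (hdm : ∀ x : κ × ι, ‖⟪u x.2, v x.1⟫_ℂ‖ ^ 2 * (p x.2 - q x.1) ^ 2 ≤ d x * m x) :
    ∃ U : H →L[ℂ] H, IsSelfAdjoint U ∧ U * U = 1 ∧
      traceNorm (ρ - τ) ^ 2 ≤ (∑ x, d x) * ∑ x : κ × ι, ‖⟪v x.1, U (u x.2)⟫_ℂ‖ ^ 2 * m x := by
  obtain ⟨U, hU, hU1, htr⟩ := exists_symmetry_opTrace_mul (hρ.sub hτ)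
  refine ⟨U, hU, hU1, ?_⟩
  have hentry : ∀ i j, ⟪u i, (ρ - τ) (v j)⟫_ℂ = ((p i - q j : ℝ) : ℂ) * ⟪u i, v j⟫_ℂ := by
    intro i j
    rw [sub_apply, inner_sub_right, inner_apply_of_apply_eq_smul hρ (hu i), hv, inner_smul_right]
    push_cast; ring
  have hle : |traceNorm (ρ - τ)| ≤
      ∑ x : κ × ι, ‖⟪v x.1, U (u x.2)⟫_ℂ‖ * (|p x.2 - q x.1| * ‖⟪u x.2, v x.1⟫_ℂ‖) := by
    rw [htr, opTrace_mul_eq_sum_inner U (ρ - τ) u v, ← Fintype.sum_prod_type']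
    refine (Complex.abs_re_le_norm _).trans ((norm_sum_le _ _).trans_eq ?_)
    refine Finset.sum_congr rfl fun x _ => ?_
    rw [hentry, norm_mul, norm_mul, Complex.norm_real, Real.norm_eq_abs]
  rw [← sq_abs]
  refine (pow_le_pow_left₀ (abs_nonneg _) hle 2).trans ?_
  refine Finset.sum_sq_le_sum_mul_sum_of_sq_le_mul _ (fun x _ => hd x)
    (fun x _ => mul_nonneg (by positivity) (hm x)) fun x _ => ?_
  rw [mul_pow, mul_pow, sq_abs]
  calc _ = ‖⟪v x.1, U (u x.2)⟫_ℂ‖ ^ 2 * (‖⟪u x.2, v x.1⟫_ℂ‖ ^ 2 * (p x.2 - q x.1) ^ 2) := by ring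
    _ ≤ ‖⟪v x.1, U (u x.2)⟫_ℂ‖ ^ 2 * (d x * m x) := mul_le_mul_of_nonneg_left (hdm x) (by positivity)
    _ = _ := by ring

/-- Quantum Pinsker inequality `‖ρ - τ‖₁² ≤ 2 Tr ρ (log ρ - log τ)`. -/
theorem IsDensityMatrix.traceNorm_sub_sq_le {ρ τ : H →L[ℂ] H} (hρ : IsDensityMatrix ρ)
    (hτ : IsDensityMatrix τ) (hker : ∀ x, τ x = 0 → ρ x = 0) :
    traceNorm (ρ - τ) ^ 2 ≤
      2 * (-vonNeumannEntropy ρ - (opTrace (ρ * cfc Real.log τ)).re) := by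
  have hρs := hρ.isPositive.isSelfAdjoint
  have hτs := hτ.isPositive.isSelfAdjoint
  obtain ⟨u, p, hu⟩ := exists_eigenbasis hρs
  obtain ⟨v, q, hv⟩ := exists_eigenbasis hτs
  have hp := hρ.isPositive.eigenvalue_nonneg hu
  have hq := hτ.isPositive.eigenvalue_nonneg hv
  set w : Fin (Module.finrank ℂ H) → Fin (Module.finrank ℂ H) → ℝ :=
    fun j i => ‖⟪u i, v j⟫_ℂ‖ ^ 2 with hw
  have hw0 : ∀ j i, 0 ≤ w j i := fun j i => by positivity
  have hwi : ∀ j, ∑ i, w j i = 1 := fun j => by simp [hw, u.sum_sq_norm_inner_right]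
  have hwj : ∀ i, ∑ j, w j i = 1 := fun i => by simp [hw, v.sum_sq_norm_inner_left]
  -- The kernel condition makes the convention log 0 = 0 harmless: it is only met with weight zero.
  have hzero : ∀ i j, q j = 0 → w j i * p i = 0 := by
    intro i j h
    have h1 : ρ (v j) = 0 := hker _ (by simp [hv, h])
    have h2 := inner_apply_of_apply_eq_smul hρs (hu i) (v j)
    rw [h1, inner_zero_right, eq_comm, mul_eq_zero] at h2
    rcases h2 with h2 | h2
    · have : p i = 0 := by simpa using h2
      simp [this]
    · simp [hw, h2]
  set g : ℝ → ℝ → ℝ := fun x y => x * Real.log x - x * Real.log y - x + y with hg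
  have hkey : ∀ j i, w j i * (p i - q j) ^ 2 ≤ w j i * g (p i) (q j) * ((2 * p i + 4 * q j) / 3) := by
    intro j i
    rcases (hq j).eq_or_lt with h | h
    · rcases mul_eq_zero.1 (hzero i j h.symm) with h' | h' <;> simp [h', ← h, hg]
    · rw [mul_assoc]
      exact mul_le_mul_of_nonneg_left (sq_sub_le_relativeEntropy (hp i) h) (hw0 j i)
  have hd0 : ∀ j i, 0 ≤ w j i * g (p i) (q j) := by
    intro j i
    rcases (hq j).eq_or_lt with h | h
    · rcases mul_eq_zero.1 (hzero i j h.symm) with h' | h' <;> simp [h', ← h, hg]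
    · refine mul_nonneg (hw0 j i) (le_of_mul_le_mul_right (a := (2 * p i + 4 * q j) / 3) ?_ ?_)
      · rw [zero_mul]
        exact (sq_nonneg _).trans (sq_sub_le_relativeEntropy (hp i) h)
      · have := hp i
        positivity
  obtain ⟨U, hU, hU1, hle⟩ := traceNorm_sub_sq_le_sum_mul_sum hρs hτs hu hv
    (m := fun x => (2 * p x.2 + 4 * q x.1) / 3) (d := fun x => w x.1 x.2 * g (p x.2) (q x.1))
    (fun x => by have := hp x.2; have := hq x.1; positivity) (fun x => hd0 x.1 x.2)
    (fun x => hkey x.1 x.2)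
  have hsp := hρ.sum_eigenvalues hu
  have hsq := hτ.sum_eigenvalues hv
  -- The matrix |⟪v j, U u i⟫|² is doubly stochastic and both spectra sum to 1, which gives 2/3 +
  -- 4/3.
  have hm : ∑ x : Fin (Module.finrank ℂ H) × Fin (Module.finrank ℂ H),
      ‖⟪v x.1, U (u x.2)⟫_ℂ‖ ^ 2 * ((2 * p x.2 + 4 * q x.1) / 3) = 2 := by
    have e1 : ∀ i, ∑ j, ‖⟪v j, U (u i)⟫_ℂ‖ ^ 2 = 1 := fun i => by
      rw [v.sum_sq_norm_inner_right, norm_apply_of_symmetry hU hU1]; simp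
    have e2 : ∀ j, ∑ i, ‖⟪v j, U (u i)⟫_ℂ‖ ^ 2 = 1 := fun j => by
      have : ∀ i, ⟪v j, U (u i)⟫_ℂ = ⟪U (v j), u i⟫_ℂ := fun i => (hU.isSymmetric (v j) (u i)).symm
      simp_rw [this]
      rw [u.sum_sq_norm_inner_left, norm_apply_of_symmetry hU hU1]; simp
    calc _ = ∑ x : Fin (Module.finrank ℂ H) × Fin (Module.finrank ℂ H),
          (2 / 3 * (p x.2 * ‖⟪v x.1, U (u x.2)⟫_ℂ‖ ^ 2)
            + 4 / 3 * (q x.1 * ‖⟪v x.1, U (u x.2)⟫_ℂ‖ ^ 2)) :=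
          Finset.sum_congr rfl fun x _ => by ring
      _ = 2 / 3 * ∑ i, p i * ∑ j, ‖⟪v j, U (u i)⟫_ℂ‖ ^ 2
            + 4 / 3 * ∑ j, q j * ∑ i, ‖⟪v j, U (u i)⟫_ℂ‖ ^ 2 := by
          rw [Finset.sum_add_distrib, ← Finset.mul_sum, ← Finset.mul_sum,
            Fintype.sum_prod_type_right, Fintype.sum_prod_type]
          simp_rw [Finset.mul_sum]
      _ = 2 := by simp_rw [e1, e2, mul_one, hsp, hsq]; norm_num
  have hd : ∑ x : Fin (Module.finrank ℂ H) × Fin (Module.finrank ℂ H),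
      w x.1 x.2 * g (p x.2) (q x.1) =
      -vonNeumannEntropy ρ - (opTrace (ρ * cfc Real.log τ)).re := by
    rw [vonNeumannEntropy, opTrace_cfc hρs _ hu, opTrace_mul_cfc hτs _ hu hv, Complex.ofReal_re,
      Complex.ofReal_re]
    calc _ = ∑ x : Fin (Module.finrank ℂ H) × Fin (Module.finrank ℂ H),
          (p x.2 * Real.log (p x.2) * w x.1 x.2 - w x.1 x.2 * (p x.2 * Real.log (q x.1))
            - p x.2 * w x.1 x.2 + q x.1 * w x.1 x.2) :=
          Finset.sum_congr rfl fun x _ => by simp only [hg]; ring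
      _ = ∑ i, p i * Real.log (p i) * ∑ j, w j i - ∑ j, ∑ i, w j i * (p i * Real.log (q j))
            - ∑ i, p i * ∑ j, w j i + ∑ j, q j * ∑ i, w j i := by
          rw [Finset.sum_add_distrib, Finset.sum_sub_distrib, Finset.sum_sub_distrib]
          simp_rw [Finset.mul_sum]
          congr 1
          · congr 1
            · congr 1
              · rw [Fintype.sum_prod_type_right]
              · rw [Fintype.sum_prod_type]
            · rw [Fintype.sum_prod_type_right]
          · rw [Fintype.sum_prod_type]
      _ = _ := by
          simp_rw [hwi, hwj, mul_one, hsp, hsq, Real.negMulLog]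
          simp [hw]
  rw [hm, hd] at hle
  linarith

end Pinsker

/-! ### Entropy of the mixture and its kernel. -/

section Concavity

variable {H : Type*} [NormedAddCommGroup H] [InnerProductSpace ℂ H] [CompleteSpace H]
  [FiniteDimensional ℂ H]

theorem vonNeumannEntropy_eq_neg_opTrace_mul_log {τ : H →L[ℂ] H} (hτ : IsSelfAdjoint τ) :
    vonNeumannEntropy τ = -(opTrace (τ * cfc Real.log τ)).re := by
  have h : τ * cfc Real.log τ = cfc (fun x => x * Real.log x) τ := by
    conv_lhs => enter [1]; rw [← cfc_id' ℝ τ hτ]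
    rw [← cfc_mul _ _ τ (continuousOn_real_spectrum _ _) (continuousOn_real_spectrum _ _)]
  obtain ⟨u, p, hu⟩ := exists_eigenbasis hτ
  rw [h, vonNeumannEntropy, opTrace_cfc hτ _ hu, opTrace_cfc hτ _ hu]
  simp [Real.negMulLog]

/-- A positive operator with vanishing quadratic form at `x` annihilates `x`. -/
theorem ContinuousLinearMap.IsPositive.apply_eq_zero_of_inner {A : H →L[ℂ] H} (hA : A.IsPositive)
    {x : H} (hx : (⟪x, A x⟫_ℂ).re = 0) : A x = 0 := by
  obtain ⟨u, p, hu⟩ := exists_eigenbasis hA.isSelfAdjoint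
  have hp := hA.eigenvalue_nonneg hu
  have hAx := fun i => inner_apply_of_apply_eq_smul hA.isSelfAdjoint (hu i) x
  have hsum : ∑ i, p i * ‖⟪u i, x⟫_ℂ‖ ^ 2 = 0 := by
    rw [← hx, ← u.sum_inner_mul_inner x (A x), Complex.re_sum]
    refine Finset.sum_congr rfl fun i _ => ?_
    rw [hAx, ← inner_conj_symm x (u i), mul_left_comm, Complex.conj_mul', Complex.re_ofReal_mul]
    norm_cast
  rw [Finset.sum_eq_zero_iff_of_nonneg fun i _ => mul_nonneg (hp i) (by positivity)] at hsum
  rw [← u.sum_repr' (A x)]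
  refine Finset.sum_eq_zero fun i hi => ?_
  rw [hAx]
  rcases mul_eq_zero.1 (hsum i hi) with h | h
  · simp [h]
  · have : ⟪u i, x⟫_ℂ = 0 := by simpa using h
    simp [this]

/-- Nonnegative quadratic forms with zero weighted sum vanish wherever the weight is positive. This
supplies Pinsker's kernel condition for the mixture. -/
theorem ContinuousLinearMap.IsPositive.apply_eq_zero_of_smul_add {A B : H →L[ℂ] H}
    (hA : A.IsPositive) (hB : B.IsPositive) {a b : ℝ} (ha : 0 < a) (hb : 0 ≤ b) {x : H}
    (hx : ((a : ℂ) • A + (b : ℂ) • B) x = 0) : A x = 0 := by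
  refine hA.apply_eq_zero_of_inner (le_antisymm ?_ (hA.re_inner_nonneg_right x))
  have h : (⟪x, ((a : ℂ) • A + (b : ℂ) • B) x⟫_ℂ).re = 0 := by
    rw [hx, inner_zero_right, Complex.zero_re]
  have hB' : 0 ≤ (⟪x, B x⟫_ℂ).re := hB.re_inner_nonneg_right x
  rw [add_apply, smul_apply, smul_apply, inner_add_right, inner_smul_right, inner_smul_right,
    Complex.add_re, Complex.re_ofReal_mul, Complex.re_ofReal_mul] at h
  have := mul_nonneg hb hB'
  by_contra hcon
  have := mul_pos ha (not_le.1 hcon)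
  linarith

end Concavity

theorem mainTheorem2 {H : Type*} [NormedAddCommGroup H] [InnerProductSpace ℂ H] [CompleteSpace H]
    [FiniteDimensional ℂ H] (ρ σ : H →L[ℂ] H) (hρ : IsDensityMatrix ρ) (hσ : IsDensityMatrix σ)
    (c : ℝ) (hc : c ∈ Set.Icc (0 : ℝ) 1) :
    vonNeumannEntropy ((c : ℂ) • ρ + ((1 - c : ℝ) : ℂ) • σ)
        - c * vonNeumannEntropy ρ - (1 - c) * vonNeumannEntropy σ
      ≥ (1 / 2) * c * (1 - c) * traceNorm (ρ - σ) ^ 2 := by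
  obtain ⟨hc0, hc1⟩ := hc
  -- At the endpoints both sides are 0; they are split off because the kernel condition can fail
  -- there.
  rcases hc0.eq_or_lt with rfl | hc0
  · simp
  rcases hc1.eq_or_lt with rfl | hc1
  · simp
  have hc1' : 0 < 1 - c := sub_pos.2 hc1
  set τ : H →L[ℂ] H := (c : ℂ) • ρ + ((1 - c : ℝ) : ℂ) • σ with hτdef
  have hτ : IsDensityMatrix τ := hρ.mix hσ hc0.le hc1.le
  have h1 := hρ.traceNorm_sub_sq_le hτ fun x hx =>
    hρ.isPositive.apply_eq_zero_of_smul_add hσ.isPositive hc0 hc1'.le hx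
  have h2 := hσ.traceNorm_sub_sq_le hτ fun x hx =>
    hσ.isPositive.apply_eq_zero_of_smul_add hρ.isPositive hc1' hc0.le (by rw [add_comm]; exact hx)
  have e1 : ρ - τ = ((1 - c : ℝ) : ℂ) • (ρ - σ) := by
    rw [hτdef]; push_cast; module
  have e2 : σ - τ = ((-c : ℝ) : ℂ) • (ρ - σ) := by
    rw [hτdef]; push_cast; module
  have e3 : (opTrace (τ * cfc Real.log τ)).re = c * (opTrace (ρ * cfc Real.log τ)).re
      + (1 - c) * (opTrace (σ * cfc Real.log τ)).re := by
    conv_lhs => enter [1, 1, 1]; rw [hτdef]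
    rw [add_mul, smul_mul_assoc, smul_mul_assoc, opTrace_add, opTrace_smul, opTrace_smul,
      Complex.add_re, Complex.re_ofReal_mul, Complex.re_ofReal_mul]
  rw [e1, traceNorm_smul, mul_pow, sq_abs] at h1
  rw [e2, traceNorm_smul, mul_pow, sq_abs] at h2
  rw [vonNeumannEntropy_eq_neg_opTrace_mul_log hτ.isPositive.isSelfAdjoint, e3]
  have h3 := mul_le_mul_of_nonneg_left h1 hc0.le
  have h4 := mul_le_mul_of_nonneg_left h2 hc1'.le
  linarith
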